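/- Let $G$ be a (not necessarily finite) group, let $m\ge 0$, and let $F(x_1,\dots,x_m)$ be the free group on unknowns $x_1,\dots,x_m$. Let $S=\{u_i(x_1,\dots,x_m)\in H_ig_iH_i \mid i\in I\}$ be a (not necessarily finite) system of generalised equations over $G$, where $g_i\in G$, the $H_i$ are subgroups of $G$, and each $u_i\in G*F(x_1,\dots,x_m)$ is given by a word in the alphabet $G\sqcup\{x_1^{\pm1},\dots,x_m^{\pm1}\}$; the elements of $G$ occurring in the words $u_i$ are called the coefficients of $S$. Let $J\subseteq I$ and let $P=\{u_j(x_1,\dots,x_m)\in H_jg_jH_j\mid j\in J\}$ be the corresponding subsystem. Put $$\tilde H=\Bigl(\bigcap_{j\in J}N(H_jg_jH_j)\Bigr)\cap\Bigl(\bigcap_{i\in I\setminus J}H_i\Bigr)\cap C,$$ where $N(A)=\{g\in G\mid g^{-1}Ag=A\}$ for a subset $A\subseteq G$, and $C$ is the centraliser in $G$ of the set of all coefficients of $S$. Let $\Delta_k\ge 0$ be the greatest common divisor of all minors of order $k$ of the matrix of $P$, that is, of the integer matrix $(a_{jl})_{j\in J,\,1\le l\le m}$ in which $a_{jl}$ is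 the exponent sum of $x_l$ in $u_j$; here $\Delta_0=1$, $\Delta_k=0$ if $k$ exceeds the number of equations of $P$, $\frac00=0$, and the ratio $\Delta_m/\Delta_{m-1}$ is read as $1$ if $m=0$. Then the number of solutions $(x_1,\dots,x_m)\in G^m$ of $S$ is divisible by $\mathrm{GCD}\bigl(\tilde H,\Delta_m/\Delta_{m-1}\bigr)$. Here, for a group $K$ and an integer $n$, $\mathrm{GCD}(K,n)$ is the least common multiple of the orders of those subgroups of $K$ whose orders divide $n$. Orders, numbers of solutions and divisibility are understood in the sense of cardinal arithmetic: an infinite cardinal is divisible by all nonzero cardinals not exceeding it, and zero is divisible by all cardinals and divides only zero; the least common multiple of a family of nonzero cardinals is the least nonzero cardinal divisible by all of them, so that $\mathrm{GCD}(K,0)=|K|$. -/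

import Mathlib

namespace GroupEquations

/-- A word in the alphabet `G ⊔ {x₁^{±1}, …, x_m^{±1}}`. The letter `Sum.inl a` is the coefficient
`a`, the letter `Sum.inr (j, true)` is `x_j` and the letter `Sum.inr (j, false)` is `x_j⁻¹`. -/
abbrev Word (G : Type*) (m : ℕ) : Type _ := List (G ⊕ (Fin m × Bool))

section Words

variable {G : Type*} [Group G] {m : ℕ}

/-- The element of the free product `G * F(x₁, …, x_m)` given by a single letter. -/
def letter : G ⊕ (Fin m × Bool) → Monoid.Coprod G (FreeGroup (Fin m))
  | Sum.inl a => Monoid.Coprod.inl a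
  | Sum.inr (j, true) => Monoid.Coprod.inr (FreeGroup.of j)
  | Sum.inr (j, false) => Monoid.Coprod.inr (FreeGroup.of j)⁻¹

/-- The element of the free product `G * F(x₁, …, x_m)` represented by a word. -/
def Word.toCoprod (w : Word G m) : Monoid.Coprod G (FreeGroup (Fin m)) :=
  (w.map letter).prod

/-- The coefficients of a word: the elements of `G` occurring in it. -/
def Word.coeffs (w : Word G m) : Set G := {a | Sum.inl a ∈ w}

/-- The value `u(x₁, …, x_m)` in `G` of an element `u` of the free product at a tuple of elements
of `G`: the homomorphism that is the identity on `G` and sends the `j`-th unknown to `x j`. -/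
def evalAt (x : Fin m → G) : Monoid.Coprod G (FreeGroup (Fin m)) →* G :=
  Monoid.Coprod.lift (MonoidHom.id G) (FreeGroup.lift x)

/-- The exponent sum of the `j`-th unknown in an element of the free product: the homomorphism
to `ℤ` that vanishes on `G`, sends the `j`-th unknown to `1` and the other unknowns to `0`. -/
def expSum (j : Fin m) (u : Monoid.Coprod G (FreeGroup (Fin m))) : ℤ :=
  Multiplicative.toAdd
    (Monoid.Coprod.lift (1 : G →* Multiplicative ℤ)
      (FreeGroup.lift fun k => Multiplicative.ofAdd (if k = j then (1 : ℤ) else 0)) u)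

/-- The set of solutions in `G` of the system of generalised equations
`w i (x₁, …, x_m) ∈ H i * g i * H i`, where `i` runs over `I`. -/
def solutions {I : Type*} (w : I → Word G m) (g : I → G) (H : I → Subgroup G) :
    Set (Fin m → G) :=
  {x | ∀ i, evalAt x (w i).toCoprod ∈ DoubleCoset.doubleCoset (g i) (H i : Set G) (H i : Set G)}

/-- The matrix of a system: its `(i, j)` entry is the exponent sum of the `j`-th unknown in the
left-hand side of the `i`-th equation. -/
def systemMatrix {I : Type*} (w : I → Word G m) : Matrix I (Fin m) ℤ :=
  Matrix.of fun i j => expSum j (w i).toCoprod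

/-- The subgroup `H̃` attached to a system indexed by `I` and its subsystem indexed by `J`: the
intersection of the normalisers of the double cosets of the subsystem, of the subgroups `H i` for
the other equations, and of the centraliser of the set of coefficients of the whole system. -/
def tildeH {I : Type*} (w : I → Word G m) (g : I → G) (H : I → Subgroup G) (J : Set I) :
    Subgroup G :=
  (⨅ j ∈ J,
      Subgroup.normalizer (DoubleCoset.doubleCoset (g j) (H j : Set G) (H j : Set G))) ⊓
    (⨅ i ∈ Jᶜ, H i) ⊓
    Subgroup.centralizer (⋃ i, (w i).coeffs)

end Words

/-- The set of minors of order `k` of a matrix, which may have infinitely many rows. -/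
def minors {ι : Type*} {m : ℕ} (A : Matrix ι (Fin m) ℤ) (k : ℕ) : Set ℤ :=
  {d | ∃ (r : Fin k ↪ ι) (c : Fin k ↪ Fin m), d = (A.submatrix r c).det}

/-- `Δ_k`: the nonnegative greatest common divisor of all minors of order `k`, that is, the
nonnegative generator of the ideal of `ℤ` spanned by them. In particular `Δ_0 = 1`, and
`Δ_k = 0` if there are no minors of order `k`. -/
noncomputable def Delta {ι : Type*} {m : ℕ} (A : Matrix ι (Fin m) ℤ) (k : ℕ) : ℕ :=
  (Submodule.IsPrincipal.generator (Ideal.span (minors A k))).natAbs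

/-- The ratio `Δ_m / Δ_{m-1}`, where `m` is the number of columns and `0 / 0 = 0`. Each `Δ_{m-1}`
divides `Δ_m`, so the division in `ℕ` is exact. For `m = 0` the value is `1`. -/
noncomputable def deltaRatio {ι : Type*} {m : ℕ} (A : Matrix ι (Fin m) ℤ) : ℕ :=
  Delta A m / Delta A (m - 1)

/-- `GCD(K, n)` for a group `K` and an integer `n ≥ 0`: the least common multiple of the orders of
the subgroups of `K` whose order divides `n`, that is, the least nonzero cardinal divisible by all
these orders. Orders and divisibility are those of cardinal arithmetic. -/
noncomputable def groupGCD (K : Type*) [Group K] (n : ℕ) : Cardinal :=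
  sInf {c : Cardinal | c ≠ 0 ∧
    ∀ L : Subgroup K, Cardinal.mk L ∣ (n : Cardinal) → Cardinal.mk L ∣ c}

end GroupEquations

/-! Let `L ≤ H̃` have order dividing `n = Δ_m / Δ_{m-1}`. As `L` centralises the coefficients, the
solutions are the homomorphisms `φ : K * F(x₁, …, x_m) → G` that are the identity on the centraliser
`K` of `L` and map the left-hand sides into the double cosets. Let `Δ_k` be `Δ_{m-1}` or, if this is
zero, the last nonzero one. For each prime `p`, a vector of cofactors of order `k` divided by `Δ_k`
is annihilated modulo `n` by the matrix of the subsystem and is nonzero modulo `p`, whence there is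
a primitive integer vector `d` annihilated modulo `n`. Grade the free product by `deg x_l = d l` and
`deg K = 0`. This grading is onto `ℤ`, and the degrees of the left-hand sides of the subsystem are
divisible by `n`, hence by `|L|`.

The group `L` acts on the solutions by conjugation. A second way to move a solution `φ` is to twist
it: if `deg t = 1`, then `φ t` may be multiplied by any element of the largest subgroup `core φ` of
`L` that is normalised by the image of `φ` and centralises the image of the elements of degree zero.
By Brauer's lemma `(v u) ^ |U|` is conjugate to `v ^ |U|` by an element of `U` whenever `u ∈ U` and
`v` normalises `U`, so twisting conjugates the values of the left-hand sides of the subsystem by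
elements of `L`; the other left-hand sides are multiplied by elements of `H_i`. The twist class of
`φ` has `|core φ|` elements, and `core φ` is also its stabiliser in `L`, so Burnside's count of the
orbits of `L` on the twist classes shows that `|L|` divides the number of solutions.
-/

namespace GroupEquations

open Function

universe u

section CardinalArithmetic

theorem sInf_commonMultiples_dvd {S : Set Cardinal} {c : Cardinal} (hc : ∀ s ∈ S, s ∣ c) :
    sInf {d : Cardinal | d ≠ 0 ∧ ∀ s ∈ S, s ∣ d} ∣ c := by
  rcases eq_or_ne c 0 with rfl | hc0
  · exact dvd_zero _
  set T := {d : Cardinal | d ≠ 0 ∧ ∀ s ∈ S, s ∣ d}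
  have hcT : c ∈ T := ⟨hc0, hc⟩
  obtain ⟨hl0, hl⟩ : sInf T ∈ T := csInf_mem ⟨c, hcT⟩
  have hle : sInf T ≤ c := csInf_le' hcT
  rcases le_or_gt Cardinal.aleph0 c with hinf | hfin
  · exact Cardinal.dvd_of_le_of_aleph0_le hl0 hle hinf
  obtain ⟨a, ha⟩ := Cardinal.lt_aleph0.1 (hle.trans_lt hfin)
  obtain ⟨b, rfl⟩ := Cardinal.lt_aleph0.1 hfin
  rw [ha] at hl0 hl ⊢
  have hgcd : ((a.gcd b : ℕ) : Cardinal) ∈ T := by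
    refine ⟨by simpa using fun h => absurd h (by simpa using hl0), fun s hs => ?_⟩
    obtain ⟨n, rfl⟩ := Cardinal.lt_aleph0.1 ((Cardinal.le_of_dvd hc0 (hc s hs)).trans_lt hfin)
    exact Cardinal.nat_coe_dvd_iff.2 (Nat.dvd_gcd (Cardinal.nat_coe_dvd_iff.1 (hl _ hs))
      (Cardinal.nat_coe_dvd_iff.1 (hc _ hs)))
  have hmin : a ≤ a.gcd b := Nat.cast_le.1 (ha ▸ csInf_le' hgcd)
  have ha0 : a ≠ 0 := by simpa using hl0
  exact Cardinal.nat_coe_dvd_iff.2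
    (Nat.gcd_eq_left_iff_dvd.1 ((Nat.gcd_le_left b (Nat.pos_of_ne_zero ha0)).antisymm hmin))

theorem groupGCD_dvd {K : Type*} [Group K] {n : ℕ} {c : Cardinal}
    (h : ∀ L : Subgroup K, Cardinal.mk L ∣ (n : Cardinal) → Cardinal.mk L ∣ c) :
    groupGCD K n ∣ c := by
  have := sInf_commonMultiples_dvd
    (S := {s | ∃ L : Subgroup K, Cardinal.mk L ∣ (n : Cardinal) ∧ Cardinal.mk L = s}) (c := c)
  simp only [Set.mem_ofPred_eq, forall_exists_index, and_imp, forall_apply_eq_imp_iff₂] at this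
  exact this h

end CardinalArithmetic

section Brauer

theorem dvd_card_of_minimalPeriod_eq {X : Type*} [Finite X] {f : X → X} (hf : Injective f) {k : ℕ}
    (hk : ∀ x, minimalPeriod f x = k) : k ∣ Nat.card X := by
  have := Fintype.ofFinite X
  let π : Equiv.Perm X := Equiv.ofBijective f (Finite.injective_iff_bijective.1 hf)
  let Ω := Quotient (MulAction.orbitRel (Subgroup.zpowers π) X)
  have := Fintype.ofFinite Ω
  have horbit (x : X) : Nat.card (MulAction.orbit (Subgroup.zpowers π) x) = k := by
    have := Fintype.ofFinite (MulAction.orbit (Subgroup.zpowers π) x)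
    rw [Nat.card_eq_fintype_card, ← MulAction.minimalPeriod_eq_card, ← hk x]
    rfl
  rw [Nat.card_congr (MulAction.selfEquivSigmaOrbits (Subgroup.zpowers π) X), Nat.card_sigma]
  exact Finset.dvd_sum fun ω _ => (horbit _).symm.dvd

/-- Take for `k` the least period of a point: it is the minimal period of every point of period `k`,
so it divides the number of these points. -/
theorem exists_isPeriodicPt_of_card_ptsOfPeriod_dvd {X : Type*} [Finite X] [Nonempty X]
    {f : X → X} (hf : Injective f) {n : ℕ}
    (hn : ∀ k, (ptsOfPeriod f k).Nonempty → Nat.card (ptsOfPeriod f k) ∣ n) :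
    ∃ x, IsPeriodicPt f n x := by
  obtain ⟨x, hx⟩ := Finite.exists_min (minimalPeriod f)
  set k := minimalPeriod f x
  have hk : 0 < k := minimalPeriod_pos_of_mem_periodicPts (hf.mem_periodicPts x)
  have hxk : IsPeriodicPt f k x := isPeriodicPt_minimalPeriod f x
  have hper (y : X) (hy : y ∈ ptsOfPeriod f k) : minimalPeriod f y = k :=
    le_antisymm (IsPeriodicPt.minimalPeriod_le hk hy) (hx y)
  have hmaps := (bijOn_ptsOfPeriod f hk).mapsTo
  have hdvd : k ∣ Nat.card (ptsOfPeriod f k) := by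
    refine dvd_card_of_minimalPeriod_eq (hmaps.restrict_inj.2 hf.injOn) fun y => ?_
    refine Eq.trans (minimalPeriod_eq_minimalPeriod_iff.2 fun j => ?_) (hper y y.2)
    rw [IsPeriodicPt, IsFixedPt, hmaps.iterate_restrict, Subtype.ext_iff]
    rfl
  exact ⟨x, hxk.trans_dvd (hdvd.trans (hn k ⟨x, hxk⟩))⟩

variable {G : Type*} [Group G] {U : Subgroup G}

theorem iterate_normalizerMonoidHom_mul (v : Subgroup.normalizer (U : Set G)) (u a : U) (k : ℕ) :
    (((fun b => U.normalizerMonoidHom v (u * b))^[k] a : U) : G) =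
      ((v : G) * u) ^ k * a * ((v : G) ^ k)⁻¹ := by
  induction k with
  | zero => simp
  | succ k ih =>
    rw [iterate_succ_apply', Subgroup.normalizerMonoidHom_apply_apply_coe, Subgroup.coe_mul, ih,
      pow_succ' ((v : G) * u), pow_succ' (v : G)]
    simp only [mul_assoc, mul_inv_rev]

/-- Brauer's lemma: the `b` with `(v * u) ^ k = b * v ^ k * b⁻¹` are the points of period `k` of
`b ↦ v * u * b * v⁻¹` and form a coset of the centraliser of `v ^ k` in `U`, so their number divides
`|U|` as soon as there are any. -/
theorem exists_mul_pow_card_eq_conj (v : Subgroup.normalizer (U : Set G)) (u : U) :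
    ∃ a : U, ((v : G) * u) ^ Nat.card U = a * (v : G) ^ Nat.card U * (a : G)⁻¹ := by
  rcases finite_or_infinite U with _ | _
  swap
  · exact ⟨1, by simp⟩
  set f : U → U := fun b => U.normalizerMonoidHom v (u * b)
  have hinj : Injective f := (U.normalizerMonoidHom v).injective.comp (mul_right_injective u)
  have hper (k : ℕ) (a : U) : IsPeriodicPt f k a ↔
      ((v : G) * u) ^ k = a * (v : G) ^ k * (a : G)⁻¹ := by
    rw [IsPeriodicPt, IsFixedPt, Subtype.ext_iff, iterate_normalizerMonoidHom_mul,
      mul_inv_eq_iff_eq_mul, eq_mul_inv_iff_mul_eq]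
  have hcard (k : ℕ) : (ptsOfPeriod f k).Nonempty → Nat.card (ptsOfPeriod f k) ∣ Nat.card U := by
    rintro ⟨a, ha⟩
    let D := (Subgroup.centralizer {(v : G) ^ k}).subgroupOf U
    suffices h : ∀ b, b ∈ ptsOfPeriod f k ↔ a⁻¹ * b ∈ D from
      (Nat.card_congr ((Equiv.mulLeft a⁻¹).subtypeEquiv h)).dvd.trans D.card_subgroup_dvd_card
    intro b
    rw [mem_ptsOfPeriod, hper, (hper k a).1 ha, Subgroup.mem_subgroupOf,
      Subgroup.mem_centralizer_singleton_iff, Subgroup.coe_mul, Subgroup.coe_inv,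
      eq_mul_inv_iff_mul_eq, mul_assoc, mul_assoc, mul_assoc, inv_mul_eq_iff_eq_mul, eq_comm]
  obtain ⟨a, ha⟩ := exists_isPeriodicPt_of_card_ptsOfPeriod_dvd hinj hcard
  exact ⟨a, (hper _ a).1 ha⟩

end Brauer

section Counting

/-- Burnside's double count identifies `X` with the product of `L` and the set of orbits. -/
theorem mk_dvd_mk_of_mk_fiber_eq_mk_stabilizer {L X Y : Type u} [Group L] [MulAction L Y]
    (p : X → Y)
    (hp : ∀ y, Cardinal.mk {x // p x = y} = Cardinal.mk (MulAction.stabilizer L y)) :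
    Cardinal.mk L ∣ Cardinal.mk X := by
  let pairsEquiv : (Σ y : Y, MulAction.stabilizer L y) ≃ Σ a : L, MulAction.fixedBy Y a :=
    (Equiv.subtypeProdEquivSigmaSubtype fun (y : Y) (a : L) => a • y = y).symm.trans
      (((Equiv.prodComm Y L).subtypeEquiv fun _ => Iff.rfl).trans
        (Equiv.subtypeProdEquivSigmaSubtype fun (a : L) (y : Y) => a • y = y))
  rw [← Cardinal.mk_congr (Equiv.sigmaFiberEquiv p), Cardinal.mk_sigma, funext hp,
    ← Cardinal.mk_sigma, Cardinal.mk_congr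
      (pairsEquiv.trans (MulAction.sigmaFixedByEquivOrbitsProdGroup L Y)), Cardinal.mk_prod]
  simp only [Cardinal.lift_id, dvd_mul_left]

theorem mk_dvd_mk_of_mk_class_eq_mk_stabilizer {L X : Type u} [Group L] [MulAction L X]
    (s : SMulCon L X)
    (hs : ∀ x, Cardinal.mk {y // s.r x y} = Cardinal.mk {a : L // s.r x (a • x)}) :
    Cardinal.mk L ∣ Cardinal.mk X := by
  refine mk_dvd_mk_of_mk_fiber_eq_mk_stabilizer (Y := s.Quotient) (Quotient.mk s.toSetoid) ?_
  refine Quotient.ind fun x => ?_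
  refine ((Cardinal.mk_congr (Equiv.subtypeEquivRight fun y => ?_)).trans (hs x)).trans
    (Cardinal.mk_congr (Equiv.subtypeEquivRight fun a => ?_))
  · exact Quotient.eq.trans ⟨s.symm, s.symm⟩
  · exact (⟨s.symm, s.symm⟩ : _ ↔ _).trans Quotient.eq.symm

end Counting

section Twist

variable {F G : Type*} [Group F] [Group G]

/-- The action of a group on the homomorphisms to it: `(a • φ) f = a * φ f * a⁻¹`. -/
scoped instance conjAction : MulAction G (F →* G) where
  smul a φ := (MulAut.conj a).toMonoidHom.comp φ
  one_smul φ := MonoidHom.ext fun f => DFunLike.congr_fun (map_one MulAut.conj) (φ f)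
  mul_smul a b φ := MonoidHom.ext fun f => DFunLike.congr_fun (map_mul MulAut.conj a b) (φ f)

theorem conj_smul_apply (a : G) (φ : F →* G) (f : F) : (a • φ) f = a * φ f * a⁻¹ := rfl

variable (deg : F →* Multiplicative ℤ) (L : Subgroup G)

/-- The largest subgroup of `L` that is normalised by the image of `φ` and centralises the image of
the kernel of `deg`. -/
def core (φ : F →* G) : Subgroup G :=
  ⨅ f, (L ⊓ Subgroup.centralizer (φ '' deg.ker)).comap (MulAut.conj (φ f)).toMonoidHom

variable {deg L} {φ ψ χ : F →* G} {a h : G} {f t : F}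

theorem mem_core :
    a ∈ core deg L φ ↔ ∀ f, φ f * a * (φ f)⁻¹ ∈ L ⊓ Subgroup.centralizer (φ '' deg.ker) :=
  Subgroup.mem_iInf

theorem core_le_inf_centralizer :
    core deg L φ ≤ L ⊓ Subgroup.centralizer (φ '' deg.ker) := fun a ha => by
  simpa only [map_one, one_mul, inv_one, mul_one] using mem_core.1 ha 1

theorem core_le : core deg L φ ≤ L := core_le_inf_centralizer.trans inf_le_left

theorem commute_of_mem_core (ha : a ∈ core deg L φ) (hf : f ∈ deg.ker) : Commute (φ f) a :=
  Subgroup.mem_centralizer_iff.1 (core_le_inf_centralizer ha).2 _ ⟨f, hf, rfl⟩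

theorem map_mem_normalizer_core (φ : F →* G) (f : F) :
    φ f ∈ Subgroup.normalizer (core deg L φ : Set G) := by
  have conj_mem (f : F) {a : G} (ha : a ∈ core deg L φ) : φ f * a * (φ f)⁻¹ ∈ core deg L φ :=
    mem_core.2 fun f' => by
      simpa only [map_mul, mul_inv_rev, mul_assoc] using mem_core.1 ha (f' * f)
  refine Subgroup.mem_normalizer_iff.2 fun a => ⟨conj_mem f, fun ha => ?_⟩
  simpa [mul_assoc] using conj_mem f⁻¹ ha

theorem conj_mem_core_smul (hh : h ∈ L) (ha : a ∈ core deg L φ) :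
    h * a * h⁻¹ ∈ core deg L (h • φ) := by
  refine mem_core.2 fun f => ?_
  have hconj : (h • φ) f * (h * a * h⁻¹) * ((h • φ) f)⁻¹ = h * (φ f * a * (φ f)⁻¹) * h⁻¹ := by
    rw [conj_smul_apply]; group
  obtain ⟨hL, hC⟩ := mem_core.1 ha f
  rw [hconj]
  refine ⟨L.mul_mem (L.mul_mem hh hL) (L.inv_mem hh), Subgroup.mem_centralizer_iff.2 ?_⟩
  rintro _ ⟨k, hk, rfl⟩
  have hcomm : Commute (φ k) (φ f * a * (φ f)⁻¹) := Subgroup.mem_centralizer_iff.1 hC _ ⟨k, hk, rfl⟩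
  simp only [conj_smul_apply]
  exact (Commute.conj_iff h).2 hcomm

variable (deg L) in
/-- `ψ` is a twist of `φ` if it is obtained by multiplying the values of `φ` by elements of the
core of `φ`, without changes on the kernel of `deg`. -/
def IsTwist (φ ψ : F →* G) : Prop :=
  (∀ f, (φ f)⁻¹ * ψ f ∈ core deg L φ) ∧ Set.EqOn φ ψ deg.ker

namespace IsTwist

theorem refl (φ : F →* G) : IsTwist deg L φ φ :=
  ⟨fun f => by simp only [inv_mul_cancel, one_mem], Set.eqOn_refl _ _⟩

theorem core_le_core (hφψ : IsTwist deg L φ ψ) : core deg L φ ≤ core deg L ψ := fun a ha => by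
  refine mem_core.2 fun f => ?_
  have hmem := mem_core.1 (mul_mem (mul_mem (hφψ.1 f) ha) (inv_mem (hφψ.1 f))) f
  rw [hφψ.2.image_eq] at hmem
  convert hmem using 1
  group

theorem symm (hφψ : IsTwist deg L φ ψ) : IsTwist deg L ψ φ :=
  ⟨fun f => hφψ.core_le_core <| by simpa using inv_mem (hφψ.1 f), hφψ.2.symm⟩

theorem core_eq (hφψ : IsTwist deg L φ ψ) : core deg L φ = core deg L ψ :=
  hφψ.core_le_core.antisymm hφψ.symm.core_le_core

theorem trans (hφψ : IsTwist deg L φ ψ) (hψχ : IsTwist deg L ψ χ) : IsTwist deg L φ χ := by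
  refine ⟨fun f => ?_, hφψ.2.trans hψχ.2⟩
  have hmem : (ψ f)⁻¹ * χ f ∈ core deg L φ := hφψ.core_eq ▸ hψχ.1 f
  simpa [mul_assoc] using mul_mem (hφψ.1 f) hmem

theorem smul (hh : h ∈ L) (hφψ : IsTwist deg L φ ψ) : IsTwist deg L (h • φ) (h • ψ) := by
  refine ⟨fun f => ?_, fun f hf => by simp only [conj_smul_apply, hφψ.2 hf]⟩
  simpa [conj_smul_apply, mul_assoc] using conj_mem_core_smul hh (hφψ.1 f)

end IsTwist

theorem isTwist_smul_iff (hh : h ∈ L) : IsTwist deg L φ (h • φ) ↔ h ∈ core deg L φ := by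
  refine ⟨fun ht => mem_core.2 fun f => ?_, fun hc => ⟨fun f => ?_, fun f hf => ?_⟩⟩
  · have hC : h ∈ Subgroup.centralizer (φ '' deg.ker) := by
      refine Subgroup.mem_centralizer_iff.2 ?_
      rintro _ ⟨k, hk, rfl⟩
      exact eq_mul_inv_iff_mul_eq.1 (ht.2 hk)
    simpa [conj_smul_apply, mul_assoc] using
      mul_mem (core_le_inf_centralizer (ht.1 f⁻¹)) (Subgroup.mem_inf.2 ⟨hh, hC⟩)
  · have hconj := (Subgroup.mem_normalizer_iff''.1 (map_mem_normalizer_core φ f) h).1 hc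
    simpa [conj_smul_apply, mul_assoc] using mul_mem hconj (inv_mem hc)
  · rw [conj_smul_apply, ← (commute_of_mem_core hc hf).eq, mul_inv_cancel_right]

theorem mul_zpow_inv_mem_ker (ht : deg t = Multiplicative.ofAdd 1) (f : F) :
    f * (t ^ (deg f).toAdd)⁻¹ ∈ deg.ker := by
  rw [MonoidHom.mem_ker, map_mul, map_inv, map_zpow, ht, ← ofAdd_zsmul, smul_eq_mul, mul_one,
    ofAdd_toAdd, mul_inv_cancel]

theorem map_eq_map_mul_zpow (φ : F →* G) (t f : F) (z : ℤ) :
    φ f = φ (f * (t ^ z)⁻¹) * φ t ^ z := by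
  rw [← map_zpow, ← map_mul, inv_mul_cancel_right]

theorem eq_of_eqOn_ker (ht : deg t = Multiplicative.ofAdd 1) (hker : Set.EqOn φ ψ deg.ker)
    (h : φ t = ψ t) : φ = ψ := MonoidHom.ext fun f => by
  rw [map_eq_map_mul_zpow φ t f (deg f).toAdd, map_eq_map_mul_zpow ψ t f (deg f).toAdd, h,
    hker (mul_zpow_inv_mem_ker ht f)]

theorem zpow_inv_mul_mul_zpow_mem {U : Subgroup G} {v u : G}
    (hv : v ∈ Subgroup.normalizer (U : Set G)) (hu : u ∈ U) (z : ℤ) :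
    (v ^ z)⁻¹ * (v * u) ^ z ∈ U := by
  induction z with
  | zero => simp
  | succ z ih =>
    convert mul_mem ((Subgroup.mem_normalizer_iff''.1 hv _).1 ih) hu using 1
    rw [zpow_add_one, zpow_add_one]
    group
  | pred z ih =>
    convert (Subgroup.mem_normalizer_iff.1 hv _).1 (mul_mem ih (inv_mem hu)) using 1
    rw [zpow_sub_one, zpow_sub_one]
    group

theorem exists_isTwist (ht : deg t = Multiplicative.ofAdd 1) (ha : a ∈ core deg L φ) :
    ∃ ψ, IsTwist deg L φ ψ ∧ ψ t = φ t * a := by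
  let c (f : F) : G := (φ t ^ (deg f).toAdd)⁻¹ * (φ t * a) ^ (deg f).toAdd
  have hc (f : F) : c f ∈ core deg L φ :=
    zpow_inv_mul_mul_zpow_mem (map_mem_normalizer_core φ t) ha _
  have hmul (f g : F) : φ (f * g) * c (f * g) = φ f * c f * (φ g * c g) := by
    have hcomm := (commute_of_mem_core (hc f) (mul_zpow_inv_mem_ker ht g)).eq
    calc φ (f * g) * c (f * g)
        = φ f * (φ (g * (t ^ (deg g).toAdd)⁻¹) * c f) * (φ t * a) ^ (deg g).toAdd := by
          simp only [c, map_mul, map_inv, map_zpow, toAdd_mul, zpow_add, mul_inv_rev, mul_assoc]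
      _ = φ f * (c f * φ (g * (t ^ (deg g).toAdd)⁻¹)) * (φ t * a) ^ (deg g).toAdd := by rw [hcomm]
      _ = φ f * c f * (φ g * c g) := by
          simp only [c, map_mul, map_inv, map_zpow, mul_assoc]
  refine ⟨MonoidHom.mk' (fun f => φ f * c f) hmul, ⟨fun f => ?_, fun f hf => ?_⟩, ?_⟩
  · simpa using hc f
  · simp [c, MonoidHom.mem_ker.1 hf]
  · simp [c, ht]

theorem mk_isTwist_eq_mk_core {F G : Type u} [Group F] [Group G] {deg : F →* Multiplicative ℤ}
    {t : F} (ht : deg t = Multiplicative.ofAdd 1) (L : Subgroup G) (φ : F →* G) :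
    Cardinal.mk {ψ // IsTwist deg L φ ψ} = Cardinal.mk (core deg L φ) := by
  let ratio (ψ : {ψ // IsTwist deg L φ ψ}) : core deg L φ := ⟨(φ t)⁻¹ * ψ.1 t, ψ.2.1 t⟩
  refine Cardinal.mk_congr (Equiv.ofBijective ratio ⟨fun ψ χ h => ?_, fun a => ?_⟩)
  · exact Subtype.ext (eq_of_eqOn_ker ht (ψ.2.2.symm.trans χ.2.2)
      (mul_left_cancel (congrArg Subtype.val h)))
  · obtain ⟨ψ, hψ, hψt⟩ := exists_isTwist ht a.2
    exact ⟨⟨ψ, hψ⟩, Subtype.ext ((congrArg _ hψt).trans (inv_mul_cancel_left _ _))⟩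

theorem IsTwist.exists_eq_conj (ht : deg t = Multiplicative.ofAdd 1) (hφψ : IsTwist deg L φ ψ)
    (hf : (Nat.card (core deg L φ) : ℤ) ∣ (deg f).toAdd) :
    ∃ a ∈ core deg L φ, ψ f = a * φ f * a⁻¹ := by
  obtain ⟨⟨a, ha⟩, hpow⟩ := exists_mul_pow_card_eq_conj
    ⟨φ t, map_mem_normalizer_core φ t⟩ (⟨(φ t)⁻¹ * ψ t, hφψ.1 t⟩ : core deg L φ)
  obtain ⟨q, hq⟩ := hf
  set k := f * (t ^ (deg f).toAdd)⁻¹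
  have hk : k ∈ deg.ker := mul_zpow_inv_mem_ker ht f
  have hz : ψ t ^ (deg f).toAdd = a * φ t ^ (deg f).toAdd * a⁻¹ := by
    rw [mul_inv_cancel_left] at hpow
    rw [hq, zpow_mul, zpow_mul, zpow_natCast, zpow_natCast, hpow, conj_zpow]
  refine ⟨a, ha, ?_⟩
  calc ψ f = ψ k * ψ t ^ (deg f).toAdd := map_eq_map_mul_zpow ψ t f _
    _ = φ k * a * φ t ^ (deg f).toAdd * a⁻¹ := by rw [← hφψ.2 hk, hz]; simp only [mul_assoc]
    _ = a * φ k * φ t ^ (deg f).toAdd * a⁻¹ := by rw [(commute_of_mem_core ha hk).eq]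
    _ = a * φ f * a⁻¹ := by rw [map_eq_map_mul_zpow φ t f (deg f).toAdd]; simp only [mul_assoc, k]

theorem mk_dvd_mk_of_forall_smul_mem_of_forall_isTwist_mem {F G : Type u} [Group F] [Group G]
    {deg : F →* Multiplicative ℤ} {L : Subgroup G} {t : F} (ht : deg t = Multiplicative.ofAdd 1)
    {Φ : Set (F →* G)} (hconj : ∀ φ ∈ Φ, ∀ a ∈ L, a • φ ∈ Φ)
    (htwist : ∀ φ ∈ Φ, ∀ ψ, IsTwist deg L φ ψ → ψ ∈ Φ) :
    Cardinal.mk L ∣ Cardinal.mk Φ := by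
  let X : SubMulAction L (F →* G) := ⟨Φ, fun a φ hφ => hconj φ hφ a a.2⟩
  let s : SMulCon L X :=
    { r := fun φ ψ => IsTwist deg L φ.1 ψ.1
      iseqv := ⟨fun φ => .refl φ.1, .symm, .trans⟩
      smul := fun a _ _ h => h.smul a.2 }
  change Cardinal.mk L ∣ Cardinal.mk X
  refine mk_dvd_mk_of_mk_class_eq_mk_stabilizer s fun φ => ?_
  have hclass : Cardinal.mk {ψ // s.r φ ψ} = Cardinal.mk {ψ // IsTwist deg L φ.1 ψ} :=
    Cardinal.mk_congr (Equiv.subtypeSubtypeEquivSubtype fun h => htwist _ φ.2 _ h)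
  have hstab : Cardinal.mk {a : L // s.r φ (a • φ)} = Cardinal.mk (core deg L φ.1) :=
    Cardinal.mk_congr ((Equiv.subtypeEquivRight fun a => isTwist_smul_iff a.2).trans
      (Equiv.subtypeSubtypeEquivSubtype fun h => core_le h))
  rw [hclass, mk_isTwist_eq_mk_core ht, hstab]

end Twist

section Dual

variable {R M : Type*} [CommRing R] [IsDomain R] [IsPrincipalIdealRing R] [AddCommGroup M]
  [Module R M] [Module.Free R M] [Module.Finite R M]

/-- In a Smith basis of `N`, the elementary divisors generate the ideal of all values of functionals
on `N`; a Bézout relation between them is the required value. -/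
theorem exists_dual_eq_one_of_forall_isMaximal {N : Submodule R M}
    (hN : ∀ P : Ideal R, P.IsMaximal → ∃ x ∈ N, ∃ φ : Module.Dual R M, φ x ∉ P) :
    ∃ x ∈ N, ∃ φ : Module.Dual R M, φ x = 1 := by
  obtain ⟨n, bM, bN, f, a, hsnf⟩ := N.smithNormalForm (Module.Free.chooseBasis R M)
  have htop : Ideal.span (Set.range a) = ⊤ := by
    by_contra hne
    obtain ⟨P, hP, hle⟩ := Ideal.exists_le_maximal _ hne
    obtain ⟨x, hx, φ, hφ⟩ := hN P hP
    refine hφ ?_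
    rw [← Subtype.coe_mk x hx, ← bN.sum_repr ⟨x, hx⟩, Submodule.coe_sum, map_sum]
    refine P.sum_mem fun i _ => ?_
    rw [Submodule.coe_smul, hsnf, map_smul, map_smul, smul_eq_mul, smul_eq_mul]
    exact P.mul_mem_left _ (P.mul_mem_right _ (hle (Ideal.subset_span ⟨i, rfl⟩)))
  obtain ⟨s, hs⟩ := Ideal.mem_span_range_iff_exists_fun.1 ((Ideal.eq_top_iff_one _).1 htop)
  refine ⟨∑ i, (bN i : M), N.sum_mem fun i _ => (bN i).2, ∑ i, s i • bM.coord (f i), ?_⟩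
  rw [← hs]
  simp [hsnf, Finsupp.single_apply, mul_comm]

end Dual

section Delta

open Matrix

section Cofactor

variable {R ι : Type*} [CommRing R] {k : ℕ}

/-- The vector of signed maximal minors of a matrix with one more column than rows, which is
orthogonal to the rows. -/
def cofactorVec (B : Matrix (Fin k) (Fin (k + 1)) R) : Fin (k + 1) → R :=
  fun j => (-1) ^ (j : ℕ) * (B.submatrix id j.succAbove).det

theorem mulVec_cofactorVec (A : Matrix ι (Fin (k + 1)) R) (r : Fin k → ι) (i : ι) :
    (A *ᵥ cofactorVec (A.submatrix r id)) i =
      (A.submatrix (Fin.cons i r : Fin (k + 1) → ι) id).det := by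
  rw [det_succ_row_zero, mulVec, dotProduct]
  refine Finset.sum_congr rfl fun j _ => ?_
  rw [cofactorVec, mul_left_comm, ← mul_assoc]
  rfl

end Cofactor

theorem mulVec_extend_zero {R ι κ n : Type*} [NonUnitalNonAssocSemiring R] [Fintype κ] [Fintype n]
    (A : Matrix ι n R) {c : κ → n} (hc : Injective c) (y : κ → R) :
    A *ᵥ extend c y 0 = A.submatrix id c *ᵥ y := by
  funext i
  refine (Fintype.sum_of_injective c hc _ _ (fun l hl => ?_) fun j => ?_).symm
  · rw [extend_apply' _ _ _ hl, Pi.zero_apply, mul_zero]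
  · rw [hc.extend_apply]
    rfl

variable {ι : Type*} {m : ℕ} (A : Matrix ι (Fin m) ℤ)

theorem dvd_delta_iff (k : ℕ) (z : ℤ) : z ∣ (Delta A k : ℤ) ↔ ∀ d ∈ minors A k, z ∣ d := by
  rw [Delta, Int.dvd_natAbs, ← Ideal.mem_span_singleton, ← Ideal.span_singleton_le_iff_mem,
    Ideal.span_singleton_generator, Ideal.span_le]
  exact forall₂_congr fun d _ => Ideal.mem_span_singleton

theorem delta_dvd_of_mem_minors {k : ℕ} {d : ℤ} (hd : d ∈ minors A k) : (Delta A k : ℤ) ∣ d :=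
  (dvd_delta_iff A k _).1 dvd_rfl d hd

theorem delta_zero : Delta A 0 = 1 := by
  have h : (Delta A 0 : ℤ) ∣ 1 :=
    delta_dvd_of_mem_minors A ⟨.ofIsEmpty, .ofIsEmpty, det_isEmpty.symm⟩
  exact Nat.dvd_one.1 (by exact_mod_cast h)

theorem delta_dvd_det_submatrix {k : ℕ} (r : Fin k → ι) (c : Fin k → Fin m) :
    (Delta A k : ℤ) ∣ (A.submatrix r c).det := by
  by_cases hr : Injective r
  · by_cases hc : Injective c
    · exact delta_dvd_of_mem_minors A ⟨⟨r, hr⟩, ⟨c, hc⟩, rfl⟩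
    · obtain ⟨i, j, hij, hne⟩ := not_injective_iff.1 hc
      rw [det_zero_of_column_eq hne fun l => by rw [submatrix_apply, submatrix_apply, hij]]
      exact dvd_zero _
  · obtain ⟨i, j, hij, hne⟩ := not_injective_iff.1 hr
    rw [det_zero_of_row_eq hne (funext fun l => by rw [submatrix_apply, submatrix_apply, hij])]
    exact dvd_zero _

theorem delta_dvd_delta_succ (k : ℕ) : Delta A k ∣ Delta A (k + 1) := by
  rw [← Int.natCast_dvd_natCast, dvd_delta_iff]
  rintro d ⟨r, c, rfl⟩
  rw [det_succ_row_zero]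
  refine Finset.dvd_sum fun j _ => Dvd.dvd.mul_left ?_ _
  rw [submatrix_submatrix]
  exact delta_dvd_det_submatrix A _ _

variable {A}

theorem exists_det_submatrix_eq_delta_mul {k : ℕ} (h0 : Delta A k ≠ 0) {P : Ideal ℤ} (hP : P ≠ ⊤) :
    ∃ (r : Fin k ↪ ι) (c : Fin k ↪ Fin m), ∃ q ∉ P, (A.submatrix r c).det = Delta A k * q := by
  by_contra! hall
  obtain ⟨p, rfl⟩ := (IsPrincipalIdealRing.principal P).principal
  have hdvd : Delta A k * p ∣ (Delta A k : ℤ) := by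
    rw [dvd_delta_iff]
    rintro _ ⟨r, c, rfl⟩
    obtain ⟨q, hq⟩ := delta_dvd_of_mem_minors A ⟨r, c, rfl⟩
    rw [hq]
    refine mul_dvd_mul_left _ (Ideal.mem_span_singleton.1 ?_)
    by_contra hqP
    exact hall r c q hqP hq
  refine hP ((Ideal.eq_top_iff_one _).2 (Ideal.mem_span_singleton.2 ?_))
  rw [← mul_dvd_mul_iff_left (Int.natCast_ne_zero.2 h0), mul_one]
  exact hdvd

/-- The witness consists of the cofactors of `k` suitable rows in `k + 1` columns, divided by
`Δ_k`. -/
theorem exists_notMem_and_forall_delta_div_dvd_mulVec {k : ℕ} (hk : k < m) (h0 : Delta A k ≠ 0)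
    {P : Ideal ℤ} (hP : P ≠ ⊤) :
    ∃ x : Fin m → ℤ, (∃ l, x l ∉ P) ∧
      ∀ i, ((Delta A (k + 1) / Delta A k : ℕ) : ℤ) ∣ (A *ᵥ x) i := by
  obtain ⟨r, c, q, hqP, hq⟩ := exists_det_submatrix_eq_delta_mul h0 hP
  have hΔ : (Delta A k : ℤ) ≠ 0 := Int.natCast_ne_zero.2 h0
  obtain ⟨l, hl⟩ : ∃ l, l ∉ Set.range c := by
    by_contra! hsurj
    simpa only [Fintype.card_fin, hk.not_ge] using Fintype.card_le_of_surjective c hsurj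
  let c' : Fin (k + 1) → Fin m := Fin.cons l c
  have hc' : Injective c' := Fin.cons_injective_iff.2 ⟨hl, c.injective⟩
  let B := A.submatrix id c'
  have hdvd (j : Fin (k + 1)) : (Delta A k : ℤ) ∣ cofactorVec (B.submatrix r id) j :=
    Dvd.dvd.mul_left (delta_dvd_det_submatrix A r (c' ∘ j.succAbove)) _
  choose y hy using hdvd
  have hy0 : y 0 = q := by
    rw [← mul_right_inj' hΔ, ← hy, ← hq, cofactorVec, Fin.val_zero, pow_zero, one_mul]
    rfl
  refine ⟨extend c' y 0, ⟨l, ?_⟩, fun i => ?_⟩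
  · rwa [← Fin.cons_zero (α := fun _ => Fin m) l c, hc'.extend_apply, hy0]
  · have hmul : Delta A k * (B *ᵥ y) i = (B *ᵥ cofactorVec (B.submatrix r id)) i := by
      rw [show cofactorVec (B.submatrix r id) = (Delta A k : ℤ) • y from funext hy, mulVec_smul,
        Pi.smul_apply, smul_eq_mul]
    rw [mulVec_extend_zero A hc', ← mul_dvd_mul_iff_left hΔ, hmul, mulVec_cofactorVec,
      ← Nat.cast_mul, Nat.mul_div_cancel' (delta_dvd_delta_succ A k)]
    exact delta_dvd_det_submatrix A _ c'

theorem exists_deltaRatio_eq (A : Matrix ι (Fin (m + 1)) ℤ) :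
    ∃ k < m + 1, Delta A k ≠ 0 ∧ deltaRatio A = Delta A (k + 1) / Delta A k := by
  classical
  by_cases hm : Delta A m = 0
  · have hex : ∃ k, Delta A k = 0 := ⟨m, hm⟩
    have hpos : Nat.find hex ≠ 0 := fun h0 =>
      one_ne_zero ((delta_zero A).symm.trans ((Nat.find_eq_zero hex).1 h0))
    obtain ⟨k, hk⟩ := Nat.exists_eq_succ_of_ne_zero hpos
    have hkm : k + 1 ≤ m := hk.symm.trans_le (Nat.find_min' hex hm)
    have hsucc : Delta A (k + 1) = 0 := (congrArg (Delta A) hk).symm.trans (Nat.find_spec hex)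
    refine ⟨k, by lia, Nat.find_min hex (by lia), ?_⟩
    rw [deltaRatio, Nat.add_sub_cancel, hm, hsucc, Nat.div_zero, Nat.zero_div]
  · exact ⟨m, m.lt_succ_self, hm, rfl⟩

theorem exists_dotProduct_eq_one_and_forall_deltaRatio_dvd_mulVec (A : Matrix ι (Fin (m + 1)) ℤ) :
    ∃ d t : Fin (m + 1) → ℤ, d ⬝ᵥ t = 1 ∧ ∀ i, (deltaRatio A : ℤ) ∣ (A *ᵥ d) i := by
  obtain ⟨k, hk, hΔ, hratio⟩ := exists_deltaRatio_eq A
  let N : Submodule ℤ (Fin (m + 1) → ℤ) :=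
    (Submodule.pi Set.univ fun _ : ι => Ideal.span {(deltaRatio A : ℤ)}).comap A.mulVecLin
  have hN (x : Fin (m + 1) → ℤ) : x ∈ N ↔ ∀ i, (deltaRatio A : ℤ) ∣ (A *ᵥ x) i := by
    simp only [N, Submodule.mem_comap, Submodule.mem_pi, Set.mem_univ, true_imp_iff,
      mulVecLin_apply, Ideal.mem_span_singleton]
  obtain ⟨d, hd, φ, hφ⟩ := exists_dual_eq_one_of_forall_isMaximal (N := N) fun P hP => by
    obtain ⟨x, ⟨l, hl⟩, hx⟩ := exists_notMem_and_forall_delta_div_dvd_mulVec hk hΔ hP.ne_top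
    exact ⟨x, (hN x).2 (hratio ▸ hx), LinearMap.proj l, hl⟩
  exact ⟨d, _, (φ.pi_apply_eq_sum_univ d).symm.trans hφ, (hN d).1 hd⟩

end Delta

section FreeProduct

open Monoid.Coprod

variable {G : Type*} [Group G] {m : ℕ}

theorem expSum_mul (j : Fin m) (u v : Monoid.Coprod G (FreeGroup (Fin m))) :
    expSum j (u * v) = expSum j u + expSum j v := by
  simp only [expSum, map_mul, toAdd_mul]

theorem expSum_inl (j : Fin m) (a : G) :
    expSum j (inl a : Monoid.Coprod G (FreeGroup (Fin m))) = 0 := by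
  simp only [expSum, lift_apply_inl, MonoidHom.one_apply, toAdd_one]

theorem expSum_inr_of (j k : Fin m) :
    expSum j (inr (FreeGroup.of k) : Monoid.Coprod G (FreeGroup (Fin m))) =
      if k = j then 1 else 0 := by
  simp only [expSum, lift_apply_inr, FreeGroup.lift_apply_of, toAdd_ofAdd]

/-- The grading of `G * F(x₁, …, x_m)` by `ℤ` in which `x_l` has degree `d l` and the elements of
`G` have degree zero. -/
def weightedDegree (G : Type*) [Group G] (d : Fin m → ℤ) :
    Monoid.Coprod G (FreeGroup (Fin m)) →* Multiplicative ℤ :=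
  MonoidHom.mk' (fun u => Multiplicative.ofAdd (∑ l, expSum l u * d l)) fun u v => by
    simp only [expSum_mul, add_mul, Finset.sum_add_distrib, ofAdd_add]

theorem weightedDegree_inl (d : Fin m → ℤ) (a : G) : weightedDegree G d (inl a) = 1 := by
  simp only [weightedDegree, MonoidHom.mk'_apply, expSum_inl, zero_mul, Finset.sum_const_zero,
    ofAdd_zero]

theorem weightedDegree_inr_of (d : Fin m → ℤ) (k : Fin m) :
    weightedDegree G d (inr (FreeGroup.of k)) = Multiplicative.ofAdd (d k) := by
  simp only [weightedDegree, MonoidHom.mk'_apply, expSum_inr_of, ite_mul, one_mul, zero_mul,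
    Finset.sum_ite_eq, Finset.mem_univ, if_true]

theorem exists_weightedDegree_eq_ofAdd_one (G : Type*) [Group G] {d t : Fin m → ℤ}
    (hdt : d ⬝ᵥ t = 1) : ∃ u, weightedDegree G d u = Multiplicative.ofAdd 1 := by
  have hmem : Multiplicative.ofAdd (d ⬝ᵥ t) ∈ (weightedDegree G d).range := by
    rw [dotProduct, ofAdd_sum]
    refine Subgroup.prod_mem _ fun l _ => ⟨inr (FreeGroup.of l) ^ t l, ?_⟩
    rw [map_zpow, weightedDegree_inr_of, ← ofAdd_zsmul, smul_eq_mul, mul_comm]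
  rwa [hdt] at hmem

theorem lift_comp_map {M N M' N' P : Type*} [MulOneClass M] [MulOneClass N] [MulOneClass M']
    [MulOneClass N'] [Monoid P] (f : M' →* P) (g : N' →* P) (f' : M →* M') (g' : N →* N') :
    (lift f g).comp (map f' g') = lift (f.comp f') (g.comp g') :=
  hom_ext rfl rfl

/-- The inclusion of `K * F(x₁, …, x_m)` into `G * F(x₁, …, x_m)` for a subgroup `K` of `G`. -/
def inclCoprod (K : Subgroup G) (m : ℕ) :
    Monoid.Coprod K (FreeGroup (Fin m)) →* Monoid.Coprod G (FreeGroup (Fin m)) :=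
  map K.subtype (MonoidHom.id _)

theorem expSum_inclCoprod (K : Subgroup G) (j : Fin m)
    (u : Monoid.Coprod K (FreeGroup (Fin m))) : expSum j (inclCoprod K m u) = expSum j u := by
  rw [expSum, expSum, inclCoprod, ← MonoidHom.comp_apply, lift_comp_map]
  rfl

theorem toCoprod_mem_range_inclCoprod {K : Subgroup G} {w : Word G m} (hw : w.coeffs ⊆ K) :
    w.toCoprod ∈ (inclCoprod K m).range := by
  refine Subgroup.list_prod_mem _ fun y hy => ?_
  obtain ⟨x, hx, rfl⟩ := List.mem_map.1 hy
  rcases x with a | ⟨j, _ | _⟩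
  · exact ⟨inl ⟨a, hw hx⟩, map_apply_inl _ _ _⟩
  · exact ⟨inr (FreeGroup.of j)⁻¹, map_apply_inr _ _ _⟩
  · exact ⟨inr (FreeGroup.of j), map_apply_inr _ _ _⟩

/-- The tuples of elements of `G` as the homomorphisms from `K * F(x₁, …, x_m)` to `G` that are the
identity on the subgroup `K` of `G`. -/
def evalEquiv (K : Subgroup G) (m : ℕ) :
    (Fin m → G) ≃ {φ : Monoid.Coprod K (FreeGroup (Fin m)) →* G // φ.comp inl = K.subtype} where
  toFun x := ⟨lift K.subtype (FreeGroup.lift x), lift_comp_inl _ _⟩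
  invFun φ k := φ.1 (inr (FreeGroup.of k))
  left_inv x := funext fun k => by simp only [lift_apply_inr, FreeGroup.lift_apply_of]
  right_inv φ := Subtype.ext <| hom_ext ((lift_comp_inl _ _).trans φ.2.symm) <|
    FreeGroup.ext_hom _ _ fun k => by
      simp only [lift_comp_inr, FreeGroup.lift_apply_of, MonoidHom.comp_apply]

theorem evalAt_inclCoprod (K : Subgroup G) (x : Fin m → G)
    (u : Monoid.Coprod K (FreeGroup (Fin m))) :
    evalAt x (inclCoprod K m u) = (evalEquiv K m x).1 u := by
  rw [evalAt, inclCoprod, ← MonoidHom.comp_apply, lift_comp_map]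
  rfl

end FreeProduct

section Solutions

variable {G : Type*} [Group G] {m : ℕ}

theorem mul_mul_mem_doubleCoset {H : Subgroup G} {g h k x : G} (hh : h ∈ H) (hk : k ∈ H)
    (hx : x ∈ DoubleCoset.doubleCoset g (H : Set G) H) :
    h * x * k ∈ DoubleCoset.doubleCoset g (H : Set G) H := by
  obtain ⟨a, ha, b, hb, rfl⟩ := DoubleCoset.mem_doubleCoset.1 hx
  exact DoubleCoset.mem_doubleCoset.2
    ⟨h * a, H.mul_mem hh ha, b * k, H.mul_mem hb hk, by simp only [mul_assoc]⟩

variable {I : Type*} {w : I → Word G m} {g : I → G} {H : I → Subgroup G} {J : Set I} {a : G} {i : I}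

theorem mem_of_mem_tildeH (ha : a ∈ tildeH w g H J) (hi : i ∉ J) : a ∈ H i :=
  Subgroup.mem_iInf.1 (Subgroup.mem_iInf.1 ha.1.2 i) hi

theorem conj_mem_doubleCoset_of_mem_tildeH (ha : a ∈ tildeH w g H J) {x : G}
    (hx : x ∈ DoubleCoset.doubleCoset (g i) (H i : Set G) (H i)) :
    a * x * a⁻¹ ∈ DoubleCoset.doubleCoset (g i) (H i : Set G) (H i) := by
  by_cases hi : i ∈ J
  · exact (Subgroup.mem_iInf.1 (Subgroup.mem_iInf.1 ha.1.1 i) hi x).1 hx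
  · have haH := mem_of_mem_tildeH ha hi
    exact mul_mul_mem_doubleCoset haH (inv_mem haH) hx

theorem coeffs_subset_centralizer {L : Subgroup G} (hL : L ≤ tildeH w g H J) (i : I) :
    (w i).coeffs ⊆ Subgroup.centralizer (L : Set G) := fun a ha =>
  Subgroup.mem_centralizer_iff.2 fun _ hb =>
    (Subgroup.mem_centralizer_iff.1 (hL hb).2 a (Set.mem_iUnion.2 ⟨i, ha⟩)).symm

variable {K L : Subgroup G} {W : I → Monoid.Coprod K (FreeGroup (Fin m))}

/-- The solutions of a system with left-hand sides `W i` and coefficients in the subgroup `K`, as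
the homomorphisms from `K * F(x₁, …, x_m)` to `G` that evaluate at them. -/
def solutionHoms (W : I → Monoid.Coprod K (FreeGroup (Fin m))) (g : I → G) (H : I → Subgroup G) :
    Set (Monoid.Coprod K (FreeGroup (Fin m)) →* G) :=
  {φ | φ.comp Monoid.Coprod.inl = K.subtype ∧
    ∀ i, φ (W i) ∈ DoubleCoset.doubleCoset (g i) (H i : Set G) (H i)}

theorem mk_solutions_eq_mk_solutionHoms (hW : ∀ i, inclCoprod K m (W i) = (w i).toCoprod) :
    Cardinal.mk (solutions w g H) = Cardinal.mk (solutionHoms W g H) := by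
  refine Cardinal.mk_congr (((evalEquiv K m).subtypeEquiv fun x => ?_).trans
    (Equiv.subtypeSubtypeEquivSubtypeInter _
      fun φ : Monoid.Coprod K (FreeGroup (Fin m)) →* G =>
        ∀ i, φ (W i) ∈ DoubleCoset.doubleCoset (g i) (H i : Set G) (H i)))
  exact forall_congr' fun i => by rw [← hW i, evalAt_inclCoprod]

variable {φ ψ : Monoid.Coprod K (FreeGroup (Fin m)) →* G}

theorem smul_mem_solutionHoms (hφ : φ ∈ solutionHoms W g H) (ha : a ∈ tildeH w g H J)
    (haK : a ∈ Subgroup.centralizer (K : Set G)) : a • φ ∈ solutionHoms W g H := by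
  refine ⟨MonoidHom.ext fun k => ?_, fun i => conj_mem_doubleCoset_of_mem_tildeH ha (hφ.2 i)⟩
  rw [MonoidHom.comp_apply, conj_smul_apply, ← MonoidHom.comp_apply, hφ.1, mul_inv_eq_iff_eq_mul]
  exact (Subgroup.mem_centralizer_iff.1 haK k k.2).symm

theorem IsTwist.mem_solutionHoms {d : Fin m → ℤ} {t : Monoid.Coprod K (FreeGroup (Fin m))}
    (ht : weightedDegree K d t = Multiplicative.ofAdd 1) (hL : L ≤ tildeH w g H J)
    (hJ : ∀ j ∈ J, (Nat.card L : ℤ) ∣ ∑ l, expSum l (W j) * d l) (hφ : φ ∈ solutionHoms W g H)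
    (hφψ : IsTwist (weightedDegree K d) L φ ψ) : ψ ∈ solutionHoms W g H := by
  refine ⟨Eq.trans (MonoidHom.ext fun k => ?_) hφ.1, fun i => ?_⟩
  · exact (hφψ.2 (weightedDegree_inl d k)).symm
  by_cases hi : i ∈ J
  · have hcard : (Nat.card (core (weightedDegree K d) L φ) : ℤ) ∣ Nat.card L :=
      Int.natCast_dvd_natCast.2 (Subgroup.card_dvd_of_le core_le)
    obtain ⟨a, ha, hconj⟩ := hφψ.exists_eq_conj ht (hcard.trans (hJ i hi))
    exact hconj ▸ conj_mem_doubleCoset_of_mem_tildeH (hL (core_le ha)) (hφ.2 i)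
  · have hmem := mem_of_mem_tildeH (hL (core_le (hφψ.1 (W i)))) hi
    simpa only [one_mul, mul_inv_cancel_left] using
      mul_mul_mem_doubleCoset (one_mem _) hmem (hφ.2 i)

theorem mk_dvd_mk_solutions (hL : L ≤ tildeH w g H J) {d t : Fin m → ℤ} (hdt : d ⬝ᵥ t = 1)
    (hJ : ∀ j ∈ J, (Nat.card L : ℤ) ∣ ∑ l, expSum l (w j).toCoprod * d l) :
    Cardinal.mk L ∣ Cardinal.mk (solutions w g H) := by
  choose W hW using fun i => toCoprod_mem_range_inclCoprod (coeffs_subset_centralizer hL i)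
  obtain ⟨τ, hτ⟩ := exists_weightedDegree_eq_ofAdd_one (Subgroup.centralizer (L : Set G)) hdt
  rw [mk_solutions_eq_mk_solutionHoms hW]
  refine mk_dvd_mk_of_forall_smul_mem_of_forall_isTwist_mem hτ (fun φ hφ a ha => ?_)
    fun φ hφ ψ => IsTwist.mem_solutionHoms hτ hL (fun j hj => ?_) hφ
  · exact smul_mem_solutionHoms hφ (hL ha) (Set.subset_centralizer_centralizer ha)
  · simpa only [← hW, expSum_inclCoprod] using hJ j hj

end Solutions

end GroupEquations

theorem theorem2 {G : Type*} [Group G] {m : ℕ} {I : Type*}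
    (w : I → GroupEquations.Word G m) (g : I → G) (H : I → Subgroup G) (J : Set I) :
    GroupEquations.groupGCD (GroupEquations.tildeH w g H J)
        (GroupEquations.deltaRatio (GroupEquations.systemMatrix fun j : J => w j)) ∣
      Cardinal.mk (GroupEquations.solutions w g H) := by
  refine GroupEquations.groupGCD_dvd fun L hL => ?_
  rcases m with _ | m
  · rw [GroupEquations.deltaRatio, GroupEquations.delta_zero, Nat.div_one, Nat.cast_one] at hL
    exact hL.trans (one_dvd _)
  obtain ⟨d, t, hdt, hd⟩ :=
    GroupEquations.exists_dotProduct_eq_one_and_forall_deltaRatio_dvd_mulVec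
      (GroupEquations.systemMatrix fun j : J => w j)
  have hmap : Cardinal.mk (L.map (Subgroup.subtype _)) = Cardinal.mk L :=
    (Cardinal.mk_congr (L.equivMapOfInjective _ (Subgroup.subtype_injective _)).toEquiv).symm
  rw [← hmap] at hL ⊢
  have hcard := map_dvd Cardinal.toNat hL
  rw [Cardinal.toNat_natCast, ← Int.natCast_dvd_natCast] at hcard
  exact GroupEquations.mk_dvd_mk_solutions (Subgroup.map_subtype_le L) hdt
    fun j hj => hcard.trans (hd ⟨j, hj⟩)
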